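/- Let $N\ge 2$, $M\ge 4$ be integers with $N\le M$. Equip $\wedge^N\mathbb{C}^M$ with the inner product determined by $\langle v_1\wedge\cdots\wedge v_N,\; w_1\wedge\cdots\wedge w_N\rangle=\det[\langle v_i,w_j\rangle]_{i,j=1}^N$. An $N$-vector is called decomposable if it has the form $v_1\wedge\cdots\wedge v_N$ with $v_1,\dots,v_N\in\mathbb{C}^M$. A generalized fermionic unextendible product basis (generalized FUPB) in $\wedge^N\mathbb{C}^M$ is a linearly independent set of decomposable vectors such that the orthogonal complement of its span contains no nonzero decomposable vector. For an integer $s$ put $m(s)=(1,s,s^2,\dots,s^{M-1})\in\mathbb{C}^M$. Then the $N(M-N)+1$ decomposable vectors $$m(t)\wedge m(t+1)\wedge\cdots\wedge m(t+N-1),\qquad t=1,2,\dots,N(M-N)+1,$$ are pairwise distinct and form a generalized FUPB in $\wedge^N\mathbb{C}^M$. Moreover, this cardinality is the minimum possible: every generalized FUPB in $\wedge^N\mathbb{C}^M$ has at least $N(M-N)+1$ elements. -/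

import Mathlib

/-!
The exterior power `⋀[ℂ]^N V` of a finite-dimensional complex inner product space `V`, with the
inner product for which `⟪v₁ ∧ ⋯ ∧ v_N, w₁ ∧ ⋯ ∧ w_N⟫ = det [⟪vᵢ, wⱼ⟫]`, and generalized fermionic
unextendible product bases in it.
-/

open scoped InnerProductSpace

namespace Fermion

variable {N : ℕ} {V : Type*} [NormedAddCommGroup V] [InnerProductSpace ℂ V]

/-- The functional `⟪v₁ ∧ ⋯ ∧ v_N, ·⟫` on `⋀[ℂ]^N V`, see `wedgeFunctional_ιMulti`. -/
noncomputable def wedgeFunctional (v : Fin N → V) : ⋀[ℂ]^N V →ₗ[ℂ] ℂ :=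
  exteriorPower.alternatingMapToDual ℂ V N (fun i => innerₛₗ ℂ (v i))

theorem wedgeFunctional_ιMulti (v w : Fin N → V) :
    wedgeFunctional v (exteriorPower.ιMulti ℂ N w) =
      Matrix.det (Matrix.of fun i j => ⟪v i, w j⟫_ℂ) := by
  rw [wedgeFunctional, exteriorPower.alternatingMapToDual_apply_ιMulti, ← Matrix.det_transpose]
  rfl

theorem innerₛₗ_update [DecidableEq (Fin N)] (v : Fin N → V) (i : Fin N) (z : V) :
    (fun j => innerₛₗ ℂ (Function.update v i z j)) =
      Function.update (fun j => innerₛₗ ℂ (v j)) i (innerₛₗ ℂ z) := by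
  ext1 j
  by_cases h : j = i
  · subst h; simp
  · simp [h]

/-- The alternating map sending `(v₁, …, v_N)` to the conjugate-linear functional
`x ↦ ⟪x, v₁ ∧ ⋯ ∧ v_N⟫`. -/
noncomputable def wedgeAlternating :
    V [⋀^Fin N]→ₗ[ℂ] (⋀[ℂ]^N V →ₗ⋆[ℂ] ℂ) where
  toFun v := (starLinearEquiv ℂ (A := ℂ)).toLinearMap.comp (wedgeFunctional v)
  map_update_add' {_} v i x y := by
    ext u
    simp only [wedgeFunctional, innerₛₗ_update, map_add, AlternatingMap.map_update_add]
    simp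
  map_update_smul' {_} v i c x := by
    ext u
    simp only [wedgeFunctional, innerₛₗ_update, map_smulₛₗ, AlternatingMap.map_update_smul]
    simp
  map_eq_zero_of_eq' v i j h hij := by
    have : wedgeFunctional v = 0 :=
      (exteriorPower.alternatingMapToDual ℂ V N).map_eq_zero_of_eq
        (fun k => (innerₛₗ ℂ (v k) : V →ₗ[ℂ] ℂ)) (by simp only [h]) hij
    simp [this]

/-- The sesquilinear form of the inner product of `⋀[ℂ]^N V`: here `wedgeForm y x` is `⟪x, y⟫`. -/
noncomputable def wedgeForm : ⋀[ℂ]^N V →ₗ[ℂ] ⋀[ℂ]^N V →ₗ⋆[ℂ] ℂ :=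
  exteriorPower.alternatingMapLinearEquiv wedgeAlternating

theorem wedgeForm_ιMulti_left (w : Fin N → V) (x : ⋀[ℂ]^N V) :
    wedgeForm (exteriorPower.ιMulti ℂ N w) x = star (wedgeFunctional w x) := by
  rw [wedgeForm, exteriorPower.alternatingMapLinearEquiv_apply_ιMulti]
  rfl

theorem wedgeForm_ιMulti_ιMulti (v w : Fin N → V) :
    wedgeForm (exteriorPower.ιMulti ℂ N w) (exteriorPower.ιMulti ℂ N v) =
      Matrix.det (Matrix.of fun i j => ⟪v i, w j⟫_ℂ) := by
  rw [wedgeForm_ιMulti_left, wedgeFunctional_ιMulti, ← Matrix.det_conjTranspose]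
  congr 1
  ext i j
  simp [Matrix.conjTranspose_apply]

theorem wedgeForm_conj_symm (x y : ⋀[ℂ]^N V) : star (wedgeForm x y) = wedgeForm y x := by
  have hx : x ∈ Submodule.span ℂ (Set.range (exteriorPower.ιMulti ℂ N (M := V))) := by
    rw [exteriorPower.ιMulti_span]; trivial
  have hy : y ∈ Submodule.span ℂ (Set.range (exteriorPower.ιMulti ℂ N (M := V))) := by
    rw [exteriorPower.ιMulti_span]; trivial
  induction hx using Submodule.span_induction with
  | zero => simp
  | add a b _ _ ha hb => simp_all
  | smul c a _ ha => simp_all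
  | mem a ha =>
    obtain ⟨v, rfl⟩ := ha
    induction hy using Submodule.span_induction with
    | zero => simp
    | add a b _ _ ha hb => simp_all
    | smul c a _ ha => simp_all
    | mem a ha =>
      obtain ⟨w, rfl⟩ := ha
      rw [wedgeForm_ιMulti_left, wedgeForm_ιMulti_ιMulti, star_star, wedgeFunctional_ιMulti]

theorem wedgeForm_family {ι : Type*} [LinearOrder ι] {b : ι → V}
    (hb : Orthonormal ℂ b) (s t : Set.powersetCard ι N) :
    wedgeForm (exteriorPower.ιMulti_family ℂ N b s) (exteriorPower.ιMulti_family ℂ N b t) =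
      if s = t then 1 else 0 := by
  simp only [exteriorPower.ιMulti_family, wedgeForm_ιMulti_ιMulti]
  split_ifs with h
  · subst h
    exact (congrArg Matrix.det (Matrix.gram_eq_one_iff_orthonormal.mpr
      (hb.comp _ (RelEmbedding.injective _)))).trans Matrix.det_one
  · obtain ⟨x, hxt, hxs⟩ := (Set.powersetCard.exists_mem_notMem_iff_ne t s).mp (.symm h)
    simp only [Set.mem_range, not_exists,
      ← Set.powersetCard.mem_range_ofFinEmbEquiv_symm_iff_mem] at hxs hxt
    obtain ⟨i, rfl⟩ := hxt
    exact Matrix.det_eq_zero_of_row_eq_zero i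
      (fun j => hb.inner_eq_zero (fun hh => hxs j hh.symm))

theorem wedgeForm_self {ι : Type*} [Fintype ι] [LinearOrder ι]
    (b : OrthonormalBasis ι ℂ V) (x : ⋀[ℂ]^N V) :
    wedgeForm x x = ∑ s, (‖(b.toBasis.exteriorPower N).repr x s‖ ^ 2 : ℂ) := by
  conv_lhs => rw [← (b.toBasis.exteriorPower N).sum_repr x]
  simp [wedgeForm_family b.orthonormal, Complex.conj_mul']

/-- The inner product of `⋀[ℂ]^N V`. -/
noncomputable instance instCore [FiniteDimensional ℂ V] : InnerProductSpace.Core ℂ (⋀[ℂ]^N V) where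
  inner x y := wedgeForm y x
  conj_inner_symm x y := wedgeForm_conj_symm x y
  add_left x y z := by simp
  smul_left x y r := by simp
  re_inner_nonneg x := by
    rw [wedgeForm_self (stdOrthonormalBasis ℂ V)]
    norm_cast
    exact Finset.sum_nonneg fun _ _ => sq_nonneg _
  definite x h := by
    rw [wedgeForm_self (stdOrthonormalBasis ℂ V)] at h
    norm_cast at h
    rw [Finset.sum_eq_zero_iff_of_nonneg (fun _ _ => sq_nonneg _)] at h
    apply Module.Basis.ext_elem ((stdOrthonormalBasis ℂ V).toBasis.exteriorPower N)
    simpa using h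

noncomputable instance instNormed [FiniteDimensional ℂ V] : NormedAddCommGroup (⋀[ℂ]^N V) :=
  InnerProductSpace.Core.toNormedAddCommGroup (𝕜 := ℂ)

noncomputable instance instInner [FiniteDimensional ℂ V] : InnerProductSpace ℂ (⋀[ℂ]^N V) :=
  InnerProductSpace.ofCore _

/-- The inner product of two decomposable `N`-vectors is the determinant of the matrix of inner
products of their factors. -/
theorem inner_ιMulti_ιMulti [FiniteDimensional ℂ V] (v w : Fin N → V) :
    ⟪exteriorPower.ιMulti ℂ N v, exteriorPower.ιMulti ℂ N w⟫_ℂ =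
      Matrix.det (Matrix.of fun i j => ⟪v i, w j⟫_ℂ) :=
  wedgeForm_ιMulti_ιMulti v w

/-- An `N`-vector is decomposable if it is of the form `v₁ ∧ ⋯ ∧ v_N`. -/
def IsDecomposable (ψ : ⋀[ℂ]^N V) : Prop :=
  ∃ v : Fin N → V, ψ = exteriorPower.ιMulti ℂ N v

/-- A subspace is completely entangled if it contains no nonzero decomposable vector. -/
def IsCompletelyEntangled (W : Submodule ℂ (⋀[ℂ]^N V)) : Prop :=
  ∀ ψ ∈ W, IsDecomposable ψ → ψ = 0

/-- A generalized fermionic unextendible product basis: a set of linearly independent decomposable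
vectors whose orthogonal complement is completely entangled. -/
structure IsGeneralizedFUPB [FiniteDimensional ℂ V] (S : Set (⋀[ℂ]^N V)) : Prop where
  decomposable : ∀ ψ ∈ S, IsDecomposable ψ
  linearIndepOn : LinearIndepOn ℂ id S
  completelyEntangled : IsCompletelyEntangled (Submodule.span ℂ S)ᗮ

/-- The vector `(1, s, s², …, s^(M-1))` of `ℂ^M`. -/
noncomputable def momentVector (M s : ℕ) : EuclideanSpace ℂ (Fin M) :=
  WithLp.toLp 2 fun k => (s : ℂ) ^ (k : ℕ)

/-- The Slater determinant `m(t) ∧ m(t+1) ∧ ⋯ ∧ m(t+N-1)`, where `m(s) = (1, s, …, s^(M-1))`. -/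
noncomputable def momentSlater (N M t : ℕ) : ⋀[ℂ]^N (EuclideanSpace ℂ (Fin M)) :=
  exteriorPower.ιMulti ℂ N fun j : Fin N => momentVector M (t + j)

end Fermion

/-! Lower bound: decomposable vectors form the affine cone over the Grassmannian, of dimension
`N(M-N)+1`. If `k ≤ N(M-N)` linear forms vanished together on it only at the origin, the Plücker
algebra would be integral over `k` elements (`isIntegral_of_zeros_subset`), yet it contains
`N(M-N)+1` algebraically independent minors (`algebraicIndependent_minors`). So fewer vectors always
leave a nonzero decomposable vector orthogonal to them.

Unextendibility: reading `v j` as a polynomial `p j` of degree less than `M`, the inner product with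
the `t`-th Slater determinant is `det [p j (t+i)]`, the Casoratian at `t`. For independent `p j` it
is a nonzero polynomial of degree at most `N(M-N)`, so it cannot vanish at `N(M-N)+1` points.

Independence and distinctness then follow from the lower bound, applied to a maximal independent
subset. -/

/-! ### Plücker relations and the Plücker algebra -/

namespace Matrix

/-- Cramer's rule: the determinant is linear in the new row, with column `k` of the adjugate as
coefficients. -/
theorem det_submatrix_update {R m n : Type*} [CommRing R] [Fintype n] [DecidableEq n]
    (X : Matrix m n R) (a : n → m) (k : n) (i : m) :
    (X.submatrix (Function.update a k i) id).det = (X i ᵥ* (X.submatrix a id).adjugate) k := by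
  have h : X.submatrix (Function.update a k i) id = (X.submatrix a id).updateRow k (X i) := by
    ext l j
    by_cases hl : l = k
    · subst hl; simp
    · simp [hl]
  rw [h, ← cramer_transpose_apply, cramer_eq_adjugate_mulVec, ← adjugate_transpose,
    mulVec_transpose]

/-- The maximal minors of a matrix satisfy the Plücker relations in determinantal form. -/
theorem det_minors_update {R m n : Type*} [CommRing R] [Fintype n] [DecidableEq n]
    (X : Matrix m n R) (a b : n → m) :
    (of fun j k => (X.submatrix (Function.update a k (b j)) id).det).det =
      (X.submatrix b id).det * (X.submatrix a id).det ^ (Fintype.card n - 1) := by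
  rw [← det_adjugate, ← det_mul]
  congr 1
  ext j k
  rw [of_apply, det_submatrix_update]
  rfl

/-- A family satisfying the determinantal Plücker relations at a nonzero coordinate is the family of
maximal minors of a matrix. -/
theorem exists_minors_eq {K m n : Type*} [Field K] [Fintype n] [DecidableEq n] [Nonempty n]
    (y : (n → m) → K) (a : n → m) (ha : y a ≠ 0)
    (h : ∀ b, (of fun j k => y (Function.update a k (b j))).det =
      y b * y a ^ (Fintype.card n - 1)) :
    ∃ X : Matrix m n K, ∀ b, (X.submatrix b id).det = y b := by
  obtain ⟨k₀⟩ := ‹Nonempty n›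
  -- Scaling one column removes the surplus factor `y a ^ (card n - 1)` from every minor.
  let c : n → K := Function.update 1 k₀ ((y a ^ (Fintype.card n - 1))⁻¹)
  refine ⟨of fun i k => c k * y (Function.update a k i), fun b => ?_⟩
  have h1 : (of fun i k => c k * y (Function.update a k i)).submatrix b id =
      of fun j k => c k * (of fun j k => y (Function.update a k (b j))) j k := by
    ext; simp
  have h2 : ∏ k, c k = (y a ^ (Fintype.card n - 1))⁻¹ := by
    simp [c, Finset.prod_update_of_mem]
  rw [h1, det_mul_row, h, h2]
  field_simp

/-- The homomorphism sending the variable `y_a` to the minor with rows `a` of the generic matrix. -/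
noncomputable def pluckerHom (R m n : Type*) [CommRing R] [Fintype n] [DecidableEq n] :
    MvPolynomial (n → m) R →ₐ[R] MvPolynomial (m × n) R :=
  MvPolynomial.aeval fun a => ((mvPolynomialX m n R).submatrix a id).det

/-- The determinantal Plücker relations lie in the kernel of `pluckerHom`, and they already suffice
to reconstruct a matrix. -/
theorem exists_minors_eq_of_mem_zeroLocus {K m n : Type*} [Field K] [Fintype n] [DecidableEq n]
    [Nonempty n] (y : (n → m) → K)
    (hy : ∀ g ∈ RingHom.ker (pluckerHom K m n), MvPolynomial.aeval y g = 0) :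
    ∃ X : Matrix m n K, ∀ b, (X.submatrix b id).det = y b := by
  by_cases h0 : y = 0
  · refine ⟨0, fun b => ?_⟩
    subst h0
    simp [det_zero]
  obtain ⟨a, ha⟩ := Function.ne_iff.mp h0
  refine exists_minors_eq y a ha fun b => ?_
  have := hy ((of fun j k => MvPolynomial.X (Function.update a k (b j))).det -
    MvPolynomial.X b * MvPolynomial.X a ^ (Fintype.card n - 1)) (by
      rw [RingHom.mem_ker, map_sub, AlgHom.map_det, map_mul, map_pow, sub_eq_zero]
      simp only [pluckerHom, MvPolynomial.aeval_X]
      rw [← det_minors_update]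
      congr 1
      ext j k
      simp)
  rw [map_sub, AlgHom.map_det, map_mul, map_pow, sub_eq_zero] at this
  simp only [MvPolynomial.aeval_X] at this
  rw [← this]
  congr 1
  ext j k
  simp

theorem pluckerHom_X {R m n : Type*} [CommRing R] [Fintype n] [DecidableEq n] (a : n → m) :
    pluckerHom R m n (MvPolynomial.X a) = ((mvPolynomialX m n R).submatrix a id).det := by
  simp [pluckerHom]

theorem isHomogeneous_pluckerHom {R m n : Type*} [CommRing R] [Fintype n] [DecidableEq n]
    {g : MvPolynomial (n → m) R} {d : ℕ} (hg : g.IsHomogeneous d) :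
    (pluckerHom R m n g).IsHomogeneous (Fintype.card n * d) := by
  refine hg.aeval _ fun a => ?_
  rw [det_apply]
  refine MvPolynomial.IsHomogeneous.sum _ _ _ fun σ _ => ?_
  have h := MvPolynomial.IsHomogeneous.prod Finset.univ
    (fun i => (mvPolynomialX m n R).submatrix a id (σ i) i) (fun _ => 1)
    fun i _ => MvPolynomial.isHomogeneous_X _ _
  rw [Finset.sum_const, smul_eq_mul, mul_one, Finset.card_univ] at h
  rw [Units.smul_def]
  exact (MvPolynomial.homogeneousSubmodule (m × n) R (Fintype.card n)).toAddSubgroup.zsmul_mem h _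

/-- Passing to homogeneous components commutes with `pluckerHom`, up to the factor in degrees. -/
theorem homogeneousComponent_pluckerHom {R m n : Type*} [CommRing R] [Fintype n] [DecidableEq n]
    [Nonempty n] (g : MvPolynomial (n → m) R) (d : ℕ) :
    MvPolynomial.homogeneousComponent (Fintype.card n * d) (pluckerHom R m n g) =
      pluckerHom R m n (MvPolynomial.homogeneousComponent d g) := by
  conv_lhs => rw [← MvPolynomial.sum_homogeneousComponent g, map_sum, map_sum]
  have h (i : ℕ) : MvPolynomial.homogeneousComponent (Fintype.card n * d)
      (pluckerHom R m n (MvPolynomial.homogeneousComponent i g)) =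
      if d = i then pluckerHom R m n (MvPolynomial.homogeneousComponent i g) else 0 := by
    rw [MvPolynomial.homogeneousComponent_of_mem (isHomogeneous_pluckerHom
      (MvPolynomial.homogeneousComponent_isHomogeneous i g))]
    simp [Fintype.card_ne_zero]
  simp only [h, Finset.sum_ite_eq]
  split_ifs with hd
  · rfl
  · rw [MvPolynomial.homogeneousComponent_eq_zero, map_zero]
    simpa using hd

end Matrix

/-! ### Noether normalization of a cone and transcendence degree -/

namespace MvPolynomial

theorem homogeneousComponent_succ_mul {σ R : Type*} [CommRing R] (g l : MvPolynomial σ R)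
    (hl : l.IsHomogeneous 1) (d : ℕ) :
    homogeneousComponent (d + 1) (g * l) = homogeneousComponent d g * l := by
  conv_lhs => rw [← sum_homogeneousComponent g, Finset.sum_mul, map_sum]
  have h (i : ℕ) : homogeneousComponent (d + 1) (homogeneousComponent i g * l) =
      if d = i then homogeneousComponent i g * l else 0 := by
    rw [homogeneousComponent_of_mem ((homogeneousComponent_isHomogeneous i g).mul hl)]
    simp
  simp only [h, Finset.sum_ite_eq]
  split_ifs with hd
  · rfl
  · rw [homogeneousComponent_eq_zero, zero_mul]
    simpa using hd

/-- Linear forms that have no common zero but the origin on the cone of zeros of a homogeneous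
ideal give a Noether normalization of the cone. -/
theorem isIntegral_of_zeros_subset {K ι κ B : Type*} [Field K] [IsAlgClosed K] [Finite ι]
    [Fintype κ] [CommRing B] [IsDomain B] [Algebra K B] (φ : MvPolynomial ι K →ₐ[K] B)
    (hφ : ∀ g d, φ g = 0 → φ (homogeneousComponent d g) = 0)
    (l : κ → MvPolynomial ι K) (hl : ∀ i, (l i).IsHomogeneous 1)
    (hzero : ∀ y : ι → K, (∀ g ∈ RingHom.ker φ, aeval y g = 0) → (∀ i, aeval y (l i) = 0) → y = 0)
    (a : ι) : IsIntegral (Algebra.adjoin K (Set.range fun i => φ (l i))) (φ (X a)) := by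
  set J : Ideal (MvPolynomial ι K) := RingHom.ker φ ⊔ Ideal.span (Set.range l)
  obtain ⟨D, hD⟩ : ∃ D, idealOfVars ι K ^ D ≤ J := by
    -- Nullstellensatz: `J` has no zero but the origin, so its radical contains every variable.
    refine Ideal.exists_pow_le_of_le_radical_of_fg ?_ (idealOfVars_fg ι K)
    rw [← vanishingIdeal_zeroLocus_eq_radical (K := K), Ideal.span_le]
    rintro _ ⟨b, rfl⟩
    rw [SetLike.mem_coe, mem_vanishingIdeal_iff]
    intro y hy
    have : y = 0 := hzero y (fun g hg => hy g (Ideal.mem_sup_left hg))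
      fun i => hy _ (Ideal.mem_sup_right (Ideal.subset_span ⟨i, rfl⟩))
    simp [this]
  set L := Algebra.adjoin K (Set.range fun i => φ (l i))
  -- The aim is that this finite `L`-module contains the whole image of `φ`; being stable under `φ
  -- (X a)`, it then forces integrality.
  set T : Submodule L B := Submodule.span L
    ((fun m => φ (monomial m 1)) '' {m : ι →₀ ℕ | m.degree < D + 1})
  have hKT (c : K) {b : B} (hb : b ∈ T) : c • b ∈ T := T.smul_of_tower_mem c hb
  have low (d : ℕ) (hd : d < D + 1) (g : MvPolynomial ι K) (hg : g.IsHomogeneous d) : φ g ∈ T := by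
    rw [g.as_sum, map_sum]
    refine T.sum_mem fun m hm => ?_
    have h : m.degree = d := by
      rw [Finsupp.degree_eq_weight_one]
      exact hg (mem_support_iff.mp hm)
    rw [← mul_one (coeff m g), ← smul_eq_mul, ← smul_monomial, map_smul]
    exact hKT _ (Submodule.subset_span ⟨m, h.trans_lt hd, rfl⟩)
  have key (d : ℕ) : ∀ g : MvPolynomial ι K, g.IsHomogeneous d → φ g ∈ T := by
    induction d with
    | zero => exact low 0 (Nat.succ_pos D)
    | succ d ih =>
      intro g hg
      by_cases hd : d + 1 < D + 1
      · exact low _ hd g hg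
      have hgJ : g ∈ J := hD ((mem_pow_idealOfVars_iff D g).mpr fun x hx => by
        have : x.degree = d + 1 := by
          rw [Finsupp.degree_eq_weight_one]
          exact hg (mem_support_iff.mp hx)
        lia)
      obtain ⟨u, hu, w, hw, rfl⟩ := Submodule.mem_sup.mp hgJ
      obtain ⟨c, rfl⟩ := (Ideal.mem_span_range_iff_exists_fun).mp hw
      -- In degree `d + 1` only the degree `d` part of each `c i` matters, and `u` contributes
      -- nothing since the kernel is homogeneous.
      have h1 : φ (u + ∑ i, c i * l i) = ∑ i, φ (homogeneousComponent d (c i)) * φ (l i) := by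
        rw [← homogeneousComponent_eq_self hg, map_add, map_add, hφ u _ hu, zero_add, map_sum,
          map_sum]
        simp only [homogeneousComponent_succ_mul _ _ (hl _), map_mul]
      rw [h1]
      refine T.sum_mem fun i _ => ?_
      have h2 := T.smul_mem ⟨φ (l i), Algebra.subset_adjoin ⟨i, rfl⟩⟩
        (ih _ (homogeneousComponent_isHomogeneous d (c i)))
      rwa [Subalgebra.smul_def, smul_eq_mul, mul_comm] at h2
  have h1T : (1 : B) ∈ T := by simpa using key 0 1 (isHomogeneous_one _ _)
  refine isIntegral_of_smul_mem_submodule T (fun h => ?_) ?_ _ fun n hn => ?_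
  · rw [h, Submodule.mem_bot] at h1T
    exact one_ne_zero h1T
  · exact Submodule.fg_span (((Finsupp.finite_of_degree_le D).subset
      fun m hm => Nat.lt_succ_iff.mp hm).image _)
  · induction hn using Submodule.span_induction with
    | mem x hx =>
      obtain ⟨m, -, rfl⟩ := hx
      rw [smul_eq_mul, ← map_mul]
      exact key _ _ ((isHomogeneous_X K a).mul (isHomogeneous_monomial 1 rfl))
    | zero => simp
    | add x y _ _ hx hy => rw [smul_add]; exact T.add_mem hx hy
    | smul c x _ hx => rw [smul_comm]; exact T.smul_mem c hx

end MvPolynomial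

/-- An algebraically independent family of elements integral over an algebra with `k` generators
has at most `k` members. -/
theorem AlgebraicIndependent.card_le_of_isIntegral {K B ι κ : Type*} [Field K] [CommRing B]
    [IsDomain B] [Algebra K B] [Fintype ι] [Fintype κ] {x : ι → B}
    (hx : AlgebraicIndependent K x) (f : κ → B)
    (hf : ∀ i, IsIntegral (Algebra.adjoin K (Set.range f)) (x i)) :
    Fintype.card ι ≤ Fintype.card κ := by
  -- Integral elements lie in the matroid closure of the generators, whose rank is at most their
  -- number.
  have h1 := (AlgebraicIndependent.matroid_indep_iff.mpr hx.coe_range).encard_le_eRk_of_subset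
    (X := (AlgebraicIndependent.matroid K B).closure (Set.range f)) (by
      rintro _ ⟨i, rfl⟩
      rw [AlgebraicIndependent.matroid_closure_eq]
      exact (hf i).isAlgebraic)
  rw [Matroid.eRk_closure_eq] at h1
  have h2 := h1.trans (Matroid.eRk_le_encard _ _)
  have h3 : (Set.range f).encard ≤ Fintype.card κ := by
    rw [← Set.image_univ]
    exact (Set.encard_image_le _ _).trans (by simp)
  rw [← Set.image_univ, hx.injective.encard_image, Set.encard_univ,
    ENat.card_eq_coe_fintype_card] at h2
  exact_mod_cast h2.trans h3

/-! ### Dimension of the Grassmannian cone -/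

namespace Matrix

/-- The minor on rows `a` of the generic matrix, together with the minors obtained from it by
replacing one row of `a` with a row outside `a`, are algebraically independent. -/
theorem algebraicIndependent_minors {K m n r : Type*} [Field K] [Infinite K] [Fintype n]
    [DecidableEq n] [Nonempty n] (e : n ⊕ r ≃ m) :
    AlgebraicIndependent K fun o : Option (r × n) =>
      ((mvPolynomialX m n K).submatrix
        (o.elim (e ∘ Sum.inl) fun p => Function.update (e ∘ Sum.inl) p.2 (e (Sum.inr p.1))) id).det := by
  rw [algebraicIndependent_iff]
  intro g hg
  -- The minors take any prescribed values `z` with `z none ≠ 0`; the factor `X none` absorbs the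
  -- remaining case.
  have hz (z : Option (r × n) → K) : MvPolynomial.eval z (g * MvPolynomial.X none) = 0 := by
    rw [map_mul, MvPolynomial.eval_X]
    by_cases h0 : z none = 0
    · rw [h0, mul_zero]
    obtain ⟨k₀⟩ := ‹Nonempty n›
    let c : n → K := Function.update 1 k₀ ((z none ^ (Fintype.card n - 1))⁻¹)
    have hc : ∏ k, c k = (z none ^ (Fintype.card n - 1))⁻¹ := by
      simp [c, Finset.prod_update_of_mem]
    -- The minors of `Y` are `z none ^ card n` and `z none ^ (card n - 1) * z (some p)`; the column
    -- scaling `c` turns them into `z`.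
    let Y : Matrix m n K := of fun i k =>
      (e.symm i).elim (fun l => (z none • (1 : Matrix n n K)) l k) (fun p => z (some (p, k)))
    have hY : Y.submatrix (e ∘ Sum.inl) id = z none • (1 : Matrix n n K) := by
      ext; simp [Y]
    let X : Matrix m n K := of fun i k => c k * Y i k
    have hX (a : n → m) : (X.submatrix a id).det =
        (z none ^ (Fintype.card n - 1))⁻¹ * (Y.submatrix a id).det := by
      rw [← hc, ← det_mul_row]
      rfl
    have key : (fun o : Option (r × n) => (X.submatrix
        (o.elim (e ∘ Sum.inl) fun p => Function.update (e ∘ Sum.inl) p.2 (e (Sum.inr p.1))) id).det)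
        = z := by
      have hcard : 0 < Fintype.card n := Fintype.card_pos_iff.mpr ⟨k₀⟩
      ext o
      rw [hX]
      cases o with
      | none =>
        rw [Option.elim_none, hY, det_smul, det_one, mul_one,
          ← pow_sub_one_mul hcard.ne']
        field_simp
      | some p =>
        rw [Option.elim_some, det_submatrix_update, hY, adjugate_smul, adjugate_one, vecMul_smul,
          vecMul_one]
        simp only [Pi.smul_apply, smul_eq_mul]
        have : Y (e (Sum.inr p.1)) p.2 = z (some p) := by simp [Y]
        rw [this]
        field_simp
    have h1 := congrArg (MvPolynomial.aeval (R := K) fun p : m × n => X p.1 p.2) hg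
    rw [map_zero, ← AlgHom.comp_apply, MvPolynomial.comp_aeval] at h1
    have h2 : (fun o : Option (r × n) => (MvPolynomial.aeval (R := K) fun p : m × n => X p.1 p.2)
        ((mvPolynomialX m n K).submatrix
        (o.elim (e ∘ Sum.inl) fun p => Function.update (e ∘ Sum.inl) p.2 (e (Sum.inr p.1)))
          id).det) = z := by
      rw [← key]
      ext o
      rw [AlgHom.map_det]
      congr 1
      ext i j
      simp [mvPolynomialX]
    rw [h2] at h1
    rw [← MvPolynomial.coe_aeval_eq_eval]
    exact mul_eq_zero_of_left h1 _
  have h3 : g * MvPolynomial.X none = 0 := MvPolynomial.funext fun z => by rw [hz, map_zero]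
  exact (mul_eq_zero.mp h3).resolve_right (MvPolynomial.X_ne_zero _)

/-- Fewer than `dim + 1` linear conditions on the Plücker coordinates of a matrix have a common
solution of full rank. -/
theorem exists_minors_ne_zero {K m n r κ : Type*} [Field K] [IsAlgClosed K] [Fintype n]
    [DecidableEq n] [Nonempty n] [Fintype r] [Fintype m] [Fintype κ] (e : n ⊕ r ≃ m)
    (hκ : Fintype.card κ ≤ Fintype.card n * Fintype.card r) (c : κ → (n → m) → K) :
    ∃ X : Matrix m n K, (∃ a, (X.submatrix a id).det ≠ 0) ∧
      ∀ i, ∑ a, c i a * (X.submatrix a id).det = 0 := by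
  by_contra! hcon
  let l (i : κ) : MvPolynomial (n → m) K := ∑ a, MvPolynomial.C (c i a) * MvPolynomial.X a
  have hl (i : κ) : (l i).IsHomogeneous 1 :=
    MvPolynomial.IsHomogeneous.sum _ _ _ fun a _ =>
      (MvPolynomial.isHomogeneous_X K a).C_mul _
  have h := MvPolynomial.isIntegral_of_zeros_subset (pluckerHom K m n)
    (fun g d hg => by rw [← homogeneousComponent_pluckerHom, hg, map_zero]) l hl (by
      intro y hy hly
      obtain ⟨X, hX⟩ := exists_minors_eq_of_mem_zeroLocus y hy
      by_contra hy0
      obtain ⟨a, ha⟩ := Function.ne_iff.mp hy0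
      obtain ⟨i, hi⟩ := hcon X ⟨a, by rwa [hX]⟩
      exact hi (by simpa [l, hX] using hly i))
  have := (algebraicIndependent_minors (K := K) e).card_le_of_isIntegral
    (fun i => pluckerHom K m n (l i)) fun o => by rw [← pluckerHom_X]; exact h _
  rw [Fintype.card_option, Fintype.card_prod, mul_comm] at this
  lia

end Matrix

/-! ### The lower bound -/

namespace Fermion

/-- The basis coordinates of a decomposable vector are the minors with increasing rows; all other
coefficients are taken to be zero. -/
theorem exists_coeff_minors {N M : ℕ} (f : ⋀[ℂ]^N (EuclideanSpace ℂ (Fin M)) →ₗ[ℂ] ℂ) :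
    ∃ c : (Fin N → Fin M) → ℂ, ∀ X : Matrix (Fin M) (Fin N) ℂ,
      f (exteriorPower.ιMulti ℂ N fun j => WithLp.toLp 2 fun i => X i j) =
        ∑ a, c a * (X.submatrix a id).det := by
  classical
  let b := (EuclideanSpace.basisFun (Fin M) ℂ).toBasis
  let σ (s : Set.powersetCard (Fin M) N) : Fin N → Fin M := Set.powersetCard.ofFinEmbEquiv.symm s
  refine ⟨fun a => ∑ s, if σ s = a then f (b.exteriorPower N s) else 0, fun X => ?_⟩
  conv_lhs => rw [← (b.exteriorPower N).sum_repr (exteriorPower.ιMulti ℂ N _), map_sum]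
  simp only [Finset.sum_mul, ite_mul, zero_mul]
  rw [Finset.sum_comm]
  refine Finset.sum_congr rfl fun s _ => ?_
  rw [Finset.sum_ite_eq, if_pos (Finset.mem_univ _), map_smul, smul_eq_mul, mul_comm,
    exteriorPower.basis_repr_apply, exteriorPower.ιMultiDual_apply_ιMulti, ← Matrix.det_transpose]
  congr 2

theorem exists_ne_zero_of_card_le {N M : ℕ} (hN : 0 < N) (hNM : N ≤ M) {κ : Type*} [Fintype κ]
    (hκ : Fintype.card κ ≤ N * (M - N)) (f : κ → ⋀[ℂ]^N (EuclideanSpace ℂ (Fin M)) →ₗ[ℂ] ℂ) :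
    ∃ v : Fin N → EuclideanSpace ℂ (Fin M), exteriorPower.ιMulti ℂ N v ≠ 0 ∧
      ∀ i, f i (exteriorPower.ιMulti ℂ N v) = 0 := by
  have : Nonempty (Fin N) := ⟨⟨0, hN⟩⟩
  choose c hc using fun i => exists_coeff_minors (f i)
  obtain ⟨X, ⟨a, ha⟩, hX⟩ := Matrix.exists_minors_ne_zero (K := ℂ)
    (finSumFinEquiv.trans (finCongr (Nat.add_sub_cancel' hNM)) : Fin N ⊕ Fin (M - N) ≃ Fin M)
    (by simpa using hκ) c
  refine ⟨fun j => WithLp.toLp 2 fun i => X i j, fun h0 => ha ?_, fun i => by rw [hc, hX]⟩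
  -- Pairing with standard basis vectors recovers the nonzero minor.
  have h := wedgeFunctional_ιMulti (fun k => EuclideanSpace.single (a k) (1 : ℂ))
    fun j => WithLp.toLp 2 fun i => X i j
  rw [h0, map_zero] at h
  rw [h]
  congr 1
  ext i j
  simp [EuclideanSpace.inner_single_left]

/-- A set of vectors with completely entangled orthogonal complement has more than `N * (M - N)`
elements. -/
theorem le_encard_of_isCompletelyEntangled {N M : ℕ} (hN : 0 < N) (hNM : N ≤ M)
    (S : Set (⋀[ℂ]^N (EuclideanSpace ℂ (Fin M))))
    (hS : IsCompletelyEntangled (Submodule.span ℂ S)ᗮ) :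
    ((N * (M - N) + 1 : ℕ) : ℕ∞) ≤ S.encard := by
  by_contra! hlt
  have hfin : S.Finite := Set.finite_of_encard_le_coe (k := N * (M - N) + 1) hlt.le
  have := hfin.fintype
  have hcard : Fintype.card S ≤ N * (M - N) := by
    rw [Set.encard_eq_coe_toFinset_card, Set.toFinset_card] at hlt
    exact Nat.lt_succ_iff.mp (by exact_mod_cast hlt)
  obtain ⟨v, hv0, hv⟩ := exists_ne_zero_of_card_le hN hNM hcard
    fun ψ : S => (innerₛₗ ℂ (ψ : ⋀[ℂ]^N (EuclideanSpace ℂ (Fin M))))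
  refine hv0 (hS _ ?_ ⟨v, rfl⟩)
  rw [Submodule.mem_orthogonal]
  intro u hu
  induction hu using Submodule.span_induction with
  | mem x hx => exact hv ⟨x, hx⟩
  | zero => exact inner_zero_left _
  | add x y _ _ hx hy => rw [inner_add_left, hx, hy, add_zero]
  | smul c x _ hx => rw [inner_smul_left, hx, mul_zero]

end Fermion

/-! ### Casoratians of polynomials -/

namespace Polynomial

/-- The forward difference of a polynomial. -/
noncomputable def forwardDiff {R : Type*} [CommRing R] : R[X] →ₗ[R] R[X] := taylor 1 - LinearMap.id

theorem eval_forwardDiff_iterate {R : Type*} [CommRing R] (p : R[X]) (n : ℕ) (x : R) :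
    (forwardDiff^[n] p).eval x =
      ∑ k ∈ Finset.range (n + 1), ((-1) ^ (n - k) * n.choose k : R) * p.eval (x + k) := by
  have h (n : ℕ) : (fun x => (forwardDiff^[n] p).eval x) = (fwdDiff 1)^[n] fun x => p.eval x := by
    induction n with
    | zero => rfl
    | succ n ih =>
      rw [Function.iterate_succ_apply', Function.iterate_succ_apply', ← ih]
      ext x
      simp [forwardDiff, fwdDiff, taylor_eval]
  rw [congrFun (h n) x, fwdDiff_iter_eq_sum_shift]
  refine Finset.sum_congr rfl fun k _ => ?_
  rw [zsmul_eq_mul]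
  simp

/-- The `m`-th Taylor coefficient at 1 is the value there of a Hasse derivative, linear by the
degree bound; its constant term cancels. -/
theorem coeff_forwardDiff_of_natDegree_le {R : Type*} [CommRing R] {p : R[X]} {d : ℕ}
    (hp : p.natDegree ≤ d) (m : ℕ) (hm : d ≤ m + 1) :
    (forwardDiff p).coeff m = (m + 1) * p.coeff (m + 1) := by
  have h : hasseDeriv m p = C (p.coeff m) + C ((m + 1) * p.coeff (m + 1)) * X := by
    ext k
    rw [hasseDeriv_coeff]
    match k with
    | 0 => simp
    | 1 => simp [add_comm]
    | k + 2 =>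
      rw [coeff_eq_zero_of_natDegree_lt (by lia)]
      simp [coeff_one]
  rw [forwardDiff, LinearMap.sub_apply, coeff_sub, taylor_coeff, h]
  simp

theorem coeff_forwardDiff_iterate {R : Type*} [CommRing R] {p : R[X]} {d : ℕ}
    (hp : p.natDegree ≤ d) (i m : ℕ) (hm : d ≤ m + i) :
    (forwardDiff^[i] p).coeff m = (m + i).descFactorial i * p.coeff (m + i) := by
  induction i generalizing m with
  | zero => simp
  | succ i ih =>
    rw [Function.iterate_succ_apply', coeff_forwardDiff_of_natDegree_le (d := m + 1) _ m le_rfl,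
      ih (m + 1) (by lia)]
    · rw [Nat.descFactorial_succ]
      have : m + (i + 1) - i = m + 1 := by lia
      rw [this, show m + 1 + i = m + (i + 1) by lia]
      push_cast
      ring
    · rw [natDegree_le_iff_coeff_eq_zero]
      intro k hk
      rw [ih k (by lia), coeff_eq_zero_of_natDegree_lt (by lia), mul_zero]

/-- The factor `X ^ i` restores the degree lost to `i` differences, so degree bounds in the
Casoratian matrix depend on the column only. -/
theorem natDegree_X_pow_mul_forwardDiff_iterate_le {R : Type*} [CommRing R] {p : R[X]} {d : ℕ}
    (hp : p.natDegree ≤ d) (i : ℕ) : (X ^ i * forwardDiff^[i] p).natDegree ≤ d := by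
  rw [natDegree_le_iff_coeff_eq_zero]
  intro k hk
  rw [coeff_X_pow_mul']
  split_ifs with h
  · rw [coeff_forwardDiff_iterate hp _ _ (by lia), coeff_eq_zero_of_natDegree_lt (by lia), mul_zero]
  · rfl

theorem coeff_X_pow_mul_forwardDiff_iterate {R : Type*} [CommRing R] {p : R[X]} {d : ℕ}
    (hp : p.natDegree ≤ d) (i : ℕ) :
    (X ^ i * forwardDiff^[i] p).coeff d = d.descFactorial i * p.coeff d := by
  rw [coeff_X_pow_mul']
  split_ifs with h
  · rw [coeff_forwardDiff_iterate hp _ _ (by lia), Nat.sub_add_cancel h]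
  · rw [Nat.descFactorial_of_lt (by lia)]
    simp

theorem natDegree_prod_le_and_coeff {R ι : Type*} [CommRing R] (s : Finset ι) (f : ι → R[X])
    (d : ι → ℕ) (h : ∀ i ∈ s, (f i).natDegree ≤ d i) :
    (∏ i ∈ s, f i).natDegree ≤ ∑ i ∈ s, d i ∧
      (∏ i ∈ s, f i).coeff (∑ i ∈ s, d i) = ∏ i ∈ s, (f i).coeff (d i) := by
  classical
  induction s using Finset.induction_on with
  | empty => simp
  | insert a s ha ih =>
    obtain ⟨h1, h2⟩ := ih fun i hi => h i (Finset.mem_insert_of_mem hi)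
    have h3 := h a (Finset.mem_insert_self a s)
    rw [Finset.prod_insert ha, Finset.sum_insert ha, Finset.prod_insert ha]
    exact ⟨natDegree_mul_le_of_le h3 h1, by rw [coeff_mul_add_eq_of_natDegree_le h3 h1, h2]⟩

theorem natDegree_det_le {R n : Type*} [CommRing R] [Fintype n] [DecidableEq n]
    (A : Matrix n n R[X]) (d : n → ℕ) (h : ∀ i j, (A i j).natDegree ≤ d j) :
    A.det.natDegree ≤ ∑ j, d j := by
  rw [Matrix.det_apply]
  refine natDegree_sum_le_of_forall_le _ _ fun σ _ => ?_
  refine (natDegree_smul_le _ _).trans ?_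
  exact (natDegree_prod_le_and_coeff _ _ d fun j _ => h _ j).1

theorem coeff_det_of_natDegree_le {R n : Type*} [CommRing R] [Fintype n] [DecidableEq n]
    (A : Matrix n n R[X]) (d : n → ℕ) (h : ∀ i j, (A i j).natDegree ≤ d j) :
    A.det.coeff (∑ j, d j) = (Matrix.of fun i j => (A i j).coeff (d j)).det := by
  rw [Matrix.det_apply, Matrix.det_apply, finsetSum_coeff]
  refine Finset.sum_congr rfl fun σ _ => ?_
  rw [coeff_smul, (natDegree_prod_le_and_coeff _ _ d fun j _ => h _ j).2]
  rfl

/-- The Casoratian of polynomials in its form by differences. -/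
noncomputable def casoratian {R : Type*} [CommRing R] {N : ℕ} (q : Fin N → R[X]) : R[X] :=
  (Matrix.of fun i j : Fin N => forwardDiff^[i] (q j)).det

/-- Differences arise from shifts by a unitriangular matrix of signed binomials. -/
theorem eval_casoratian {R : Type*} [CommRing R] {N : ℕ} (q : Fin N → R[X]) (x : R) :
    (casoratian q).eval x = (Matrix.of fun i j : Fin N => (q j).eval (x + i)).det := by
  let T : Matrix (Fin N) (Fin N) R := Matrix.of fun i k => (-1) ^ (i - k : ℕ) * (i : ℕ).choose k
  have hT : T.det = 1 := by
    rw [Matrix.det_of_isLowerTriangular T fun i j hij => ?_]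
    · simp [T]
    · have : (i : ℕ) < j := hij
      simp [T, Nat.choose_eq_zero_of_lt this]
  rw [← one_mul (Matrix.det _), ← hT, ← Matrix.det_mul, casoratian, ← coe_evalRingHom,
    RingHom.map_det]
  congr 1
  ext i j
  simp only [RingHom.mapMatrix_apply, Matrix.map_apply, Matrix.of_apply, coe_evalRingHom,
    Matrix.mul_apply, T]
  rw [eval_forwardDiff_iterate,
    Fin.sum_univ_eq_sum_range (fun k => (-1) ^ (i - k : ℕ) * ((i : ℕ).choose k : R) *
      (q j).eval (x + k)) N]
  refine Finset.sum_subset (fun k hk => ?_) fun k _ hk => ?_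
  · simp only [Finset.mem_range] at hk ⊢
    lia
  · rw [Nat.choose_eq_zero_of_lt (by simpa using hk)]
    simp

theorem X_pow_mul_casoratian {R : Type*} [CommRing R] {N : ℕ} (q : Fin N → R[X]) :
    (Matrix.of fun i j : Fin N => X ^ (i : ℕ) * forwardDiff^[i] (q j)).det =
      X ^ (∑ i : Fin N, (i : ℕ)) * casoratian q := by
  rw [casoratian, ← Finset.prod_pow_eq_pow_sum, ← Matrix.det_mul_column]
  rfl

/-- The Casoratian of nonzero polynomials of distinct degrees `d j` is nonzero, of degree at most
`∑ d j - (0 + 1 + ⋯ + (N - 1))`. -/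
theorem casoratian_ne_zero {K : Type*} [Field K] [CharZero K] {N : ℕ} (q : Fin N → K[X])
    (h0 : ∀ j, q j ≠ 0) (hinj : Function.Injective fun j => (q j).natDegree) :
    casoratian q ≠ 0 ∧ (∑ i : Fin N, (i : ℕ)) + (casoratian q).natDegree ≤ ∑ j, (q j).natDegree := by
  set A : Matrix (Fin N) (Fin N) K[X] :=
    Matrix.of fun i j : Fin N => X ^ (i : ℕ) * forwardDiff^[i] (q j) with hA
  have hdeg (i j) : (A i j).natDegree ≤ (q j).natDegree :=
    natDegree_X_pow_mul_forwardDiff_iterate_le le_rfl i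
  have h1 := coeff_det_of_natDegree_le A _ hdeg
  -- Up to leading coefficients, the top coefficients are falling factorials of the degrees, so
  -- their determinant is a Vandermonde in distinct degrees.
  have h2 : (Matrix.of fun i j => (A i j).coeff (q j).natDegree) = (Matrix.of fun i j =>
      (q j).leadingCoeff * (Matrix.of fun i j : Fin N =>
        (descPochhammer K j).eval ((q i).natDegree : K)).transpose i j) := by
    ext i j
    rw [Matrix.of_apply, hA, Matrix.of_apply, coeff_X_pow_mul_forwardDiff_iterate le_rfl]
    simp [descPochhammer_eval_eq_descFactorial, mul_comm]
  rw [h2, Matrix.det_mul_row, Matrix.det_transpose,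
    ← Matrix.det_eval_matrixOfPolynomials_eq_det_vandermonde _ _
      (fun i => descPochhammer_natDegree K i) fun i => monic_descPochhammer K i] at h1
  have h3 : A.det ≠ 0 := by
    intro h
    rw [h, coeff_zero, eq_comm, mul_eq_zero, Finset.prod_eq_zero_iff] at h1
    rcases h1 with ⟨j, -, hj⟩ | h1
    · exact h0 j (leadingCoeff_eq_zero.mp hj)
    · exact Matrix.det_vandermonde_ne_zero_iff.mpr (Nat.cast_injective.comp hinj) h1
  have h4 := natDegree_det_le A _ hdeg
  rw [hA, X_pow_mul_casoratian] at h3 h4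
  have h5 := right_ne_zero_of_mul h3
  rw [natDegree_X_pow_mul _ h5] at h4
  exact ⟨h5, by lia⟩

/-- A finite-dimensional space of polynomials of degree less than `M` contains as many nonzero
polynomials of distinct degrees as its dimension. -/
theorem exists_strictMono_natDegree {K : Type*} [Field K] {N M : ℕ} (p : Fin N → K[X])
    (hp : LinearIndependent K p) (hM : ∀ j, p j ∈ degreeLT K M) :
    ∃ q : Fin N → K[X], (∀ j, q j ∈ Submodule.span K (Set.range p)) ∧ (∀ j, q j ≠ 0) ∧
      StrictMono (fun j => (q j).natDegree) ∧ ∀ j, (q j).natDegree < M := by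
  classical
  set U := Submodule.span K (Set.range p)
  have hU {u : K[X]} (hu : u ∈ U) (h0 : u ≠ 0) : u.natDegree < M := by
    have := (Submodule.span_le.mpr (Set.range_subset_iff.mpr hM) : U ≤ degreeLT K M) hu
    rw [mem_degreeLT] at this
    exact (natDegree_lt_iff_degree_lt h0).mpr this
  let D : Finset ℕ := {d ∈ Finset.range M | ∃ u ∈ U, u ≠ 0 ∧ u.natDegree = d}
  -- A nonzero element of `U` has its leading coefficient at a degree in `D`, so `dim U ≤ card D`.
  let L : U →ₗ[K] (D → K) := LinearMap.pi fun d => (lcoeff K (d : ℕ)).comp U.subtype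
  have hL : Function.Injective L := by
    rw [injective_iff_map_eq_zero]
    rintro ⟨u, hu⟩ h
    by_contra hne
    have hne' : u ≠ 0 := fun h' => hne (by simp [h'])
    have := congrFun h ⟨u.natDegree, by
      simp only [D, Finset.mem_filter, Finset.mem_range]
      exact ⟨hU hu hne', u, hu, hne', rfl⟩⟩
    exact hne' (leadingCoeff_eq_zero.mp this)
  have hcard : N ≤ D.card := by
    have := LinearMap.finrank_le_finrank_of_injective hL
    rw [finrank_span_eq_card hp] at this
    simpa using this
  obtain ⟨E, hED, hE⟩ := Finset.exists_subset_card_eq hcard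
  have hmem (j : Fin N) : E.orderEmbOfFin hE j ∈ D := hED (Finset.orderEmbOfFin_mem E hE j)
  simp only [D, Finset.mem_filter, Finset.mem_range] at hmem
  choose hlt q hq h0 hd using hmem
  exact ⟨q, hq, h0, by simpa only [hd] using (E.orderEmbOfFin hE).strictMono, by simpa only [hd]⟩

theorem _root_.StrictMono.sum_le_of_lt {N M : ℕ} (hNM : N ≤ M) {d : Fin N → ℕ} (hd : StrictMono d)
    (hM : ∀ j, d j < M) : ∑ j, d j ≤ N * (M - N) + ∑ i : Fin N, (i : ℕ) := by
  -- Descending induction: `k = N - 1 - j` larger values must fit between `d j` and `M`.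
  have h (k : ℕ) (j : Fin N) (hj : (j : ℕ) + k + 1 = N) : d j + k + 1 ≤ M := by
    induction k generalizing j with
    | zero => exact hM j
    | succ k ih =>
      have h1 := ih ⟨j + 1, by lia⟩ (by simp; lia)
      have h2 := hd (show j < ⟨j + 1, by lia⟩ from Fin.lt_def.mpr (Nat.lt_succ_self _))
      lia
  calc ∑ j, d j ≤ ∑ j : Fin N, ((M - N) + j) := Finset.sum_le_sum fun j _ => by
        have := h (N - 1 - j) j (by lia)
        lia
    _ = _ := by simp [Finset.sum_add_distrib]

/-- The determinants `det [p j (t + i)]` of linearly independent polynomials `p j` of degree less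
than `M` cannot vanish for all `t = 1, …, N (M - N) + 1`. -/
theorem exists_det_eval_add_ne_zero {K : Type*} [Field K] [CharZero K] {N M : ℕ} (hNM : N ≤ M)
    (p : Fin N → K[X]) (hp : LinearIndependent K p) (hM : ∀ j, p j ∈ degreeLT K M) :
    ∃ t ∈ Set.Icc 1 (N * (M - N) + 1),
      (Matrix.of fun i j : Fin N => (p j).eval ((t : K) + (i : ℕ))).det ≠ 0 := by
  by_contra! hcon
  obtain ⟨q, hq, h0, hmono, hlt⟩ := exists_strictMono_natDegree p hp hM
  obtain ⟨hne, hdeg⟩ := casoratian_ne_zero q h0 hmono.injective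
  have hsum := hmono.sum_le_of_lt hNM hlt
  -- Passing from `p` to `q` multiplies the determinants by `det G`, so vanishing is inherited.
  choose G hG using fun j => (Submodule.mem_span_range_iff_exists_fun K).mp (hq j)
  refine hne (eq_zero_of_natDegree_lt_card_of_eval_eq_zero (casoratian q)
    (f := fun t : Fin (N * (M - N) + 1) => ((t : ℕ) + 1 : K)) (fun a b hab => ?_) (fun t => ?_)
    (by rw [Fintype.card_fin]; lia))
  · exact Fin.ext (Nat.cast_injective (add_right_cancel hab))
  · have h := hcon (t + 1) ⟨by lia, by lia⟩
    rw [eval_casoratian]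
    have : (Matrix.of fun i j : Fin N => (q j).eval (((t : ℕ) + 1 : K) + (i : ℕ))) =
        (Matrix.of fun i j : Fin N => (p j).eval (((t + 1 : ℕ) : K) + (i : ℕ))) *
          (Matrix.of fun k j => G j k) := by
      ext i j
      simp [Matrix.mul_apply, ← hG, eval_finsetSum, mul_comm]
    rw [this, Matrix.det_mul, h, zero_mul]

end Polynomial

/-! ### Moment vectors as evaluation functionals -/

namespace Fermion

/-- The polynomial with the coordinates of a vector as coefficients. -/
noncomputable def coordPolynomial (M : ℕ) : EuclideanSpace ℂ (Fin M) →ₗ[ℂ] Polynomial ℂ :=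
  (Polynomial.degreeLT ℂ M).subtype ∘ₗ (Polynomial.degreeLTEquiv ℂ M).symm.toLinearMap ∘ₗ
    (WithLp.linearEquiv 2 ℂ (Fin M → ℂ)).toLinearMap

/-- Moment vectors have real entries, so conjugation in the first argument is harmless. -/
theorem eval_coordPolynomial {M : ℕ} (v : EuclideanSpace ℂ (Fin M)) (s : ℕ) :
    (coordPolynomial M v).eval (s : ℂ) = ⟪momentVector M s, v⟫_ℂ := by
  have h := Polynomial.eval_eq_sum_degreeLTEquiv
    ((Polynomial.degreeLTEquiv ℂ M).symm v.ofLp).2 (s : ℂ)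
  change (coordPolynomial M v).eval (s : ℂ) = _ at h
  rw [h]
  simp [momentVector, PiLp.inner_apply]

theorem inner_momentSlater_ιMulti {N M t : ℕ} (v : Fin N → EuclideanSpace ℂ (Fin M)) :
    ⟪momentSlater N M t, exteriorPower.ιMulti ℂ N v⟫_ℂ =
      (Matrix.of fun i j : Fin N =>
        (coordPolynomial M (v j)).eval ((t : ℂ) + (i : ℕ))).det := by
  rw [momentSlater, inner_ιMulti_ιMulti]
  congr 1
  ext i j
  rw [Matrix.of_apply, Matrix.of_apply, ← eval_coordPolynomial, Nat.cast_add]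

theorem isCompletelyEntangled_momentSlater {N M : ℕ} (hNM : N ≤ M) :
    IsCompletelyEntangled
      (Submodule.span ℂ (momentSlater N M '' Set.Icc 1 (N * (M - N) + 1)))ᗮ := by
  rintro _ hψ ⟨v, rfl⟩
  by_contra hne
  have hv : LinearIndependent ℂ v := by
    by_contra h
    exact hne (AlternatingMap.map_linearDependent _ v h)
  have hp : LinearIndependent ℂ fun j => coordPolynomial M (v j) :=
    hv.map' (coordPolynomial M) (LinearMap.ker_eq_bot.mpr
      (Subtype.val_injective.comp ((Polynomial.degreeLTEquiv ℂ M).symm.injective.comp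
        (WithLp.linearEquiv 2 ℂ (Fin M → ℂ)).injective)))
  obtain ⟨t, ht, h⟩ := Polynomial.exists_det_eval_add_ne_zero hNM _ hp
    fun j => ((Polynomial.degreeLTEquiv ℂ M).symm (v j).ofLp).2
  rw [← inner_momentSlater_ιMulti] at h
  exact h ((Submodule.mem_orthogonal _ _).mp hψ _ (Submodule.subset_span ⟨t, ht, rfl⟩))

end Fermion

theorem mainTheorem1 (N M : ℕ) (hN : 2 ≤ N) (hM : 4 ≤ M) (hNM : N ≤ M) :
    Fermion.IsGeneralizedFUPB (Fermion.momentSlater N M '' Set.Icc 1 (N * (M - N) + 1)) ∧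
    (Fermion.momentSlater N M '' Set.Icc 1 (N * (M - N) + 1)).encard =
      ((N * (M - N) + 1 : ℕ) : ℕ∞) ∧
    ∀ S : Set (⋀[ℂ]^N (EuclideanSpace ℂ (Fin M))),
      Fermion.IsGeneralizedFUPB S → ((N * (M - N) + 1 : ℕ) : ℕ∞) ≤ S.encard := by
  have hlow := Fermion.le_encard_of_isCompletelyEntangled (zero_lt_two.trans_le hN) hNM
  have hce := Fermion.isCompletelyEntangled_momentSlater hNM
  set S := Fermion.momentSlater N M '' Set.Icc 1 (N * (M - N) + 1)
  have hfin : S.Finite := (Set.finite_Icc _ _).image _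
  have hle : S.encard ≤ ((N * (M - N) + 1 : ℕ) : ℕ∞) := by
    refine (Set.encard_image_le _ _).trans ?_
    rw [← Finset.coe_Icc, Set.encard_coe_eq_coe_finsetCard, Nat.card_Icc, Nat.add_sub_cancel]
  -- A maximal independent subset has the same span, hence the same complement; the lower bound
  -- forces it to be all of `S`.
  obtain ⟨b, hbS, hspan, hb⟩ := exists_linearIndependent ℂ S
  have hbS' : b = S := (hfin.subset hbS).eq_of_subset_of_encard_le hbS (hle.trans (hlow b (hspan ▸ hce)))
  refine ⟨⟨?_, hbS' ▸ hb, hce⟩, hle.antisymm (hlow S hce), fun T hT => hlow T hT.3⟩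
  rintro _ ⟨t, -, rfl⟩
  exact ⟨_, rfl⟩
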